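/- For $s>1$ let $k_s(x,y)=|x-y|^{-s}$ on $\mathbb{R}^p$ (with $k_s(x,x)=+\infty$), and for an $N$-point configuration $\omega_N=\{y_1,\dots,y_N\}$ let $E_s(\omega_N)=\sum_{1\le i\ne j\le N}k_s(y_i,y_j)$. A Jordan arc is a set homeomorphic to a closed segment, and a closed Jordan curve is a set homeomorphic to a circle. Let $\Gamma\subset\mathbb{R}^p$ be a rectifiable (i.e. of finite length) Jordan arc or closed Jordan curve, with length $\mathcal{H}_1(\Gamma)$, where $\mathcal{H}_1$ is the one-dimensional Hausdorff measure. A sequence $\{\omega_N\}_N$ of $N$-point configurations on $\Gamma$ is called asymptotically $s$-energy minimizing on $\Gamma$, written $\{\omega_N\}_N\in\mathrm{AEM}(\Gamma;s)$, if it satisfies the limit relation $$\lim_{N\to\infty}\frac{E_s(\omega_N)}{N^{1+s}}=\frac{2\zeta(s)}{\mathcal{H}_1(\Gamma)^s},$$ where $\zeta$ is the Riemann zeta function; this is the limit relation satisfied by the minimal $N$-point $s$-energies of $\Gamma$. A sequence $(a_n)_{n\ge1}\subset\Gamma$ is a greedy $k_s$-energy sequence on $\Gamma$ if $a_1\in\Gamma$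 is arbitrary and, for every $n\ge1$, $\sum_{i=1}^n k_s(a_{n+1},a_i)=\inf_{x\in\Gamma}\sum_{i=1}^n k_s(x,a_i)$. **Theorem 2.6.** Let $\Gamma\subset\mathbb{R}^p$ be a rectifiable Jordan arc or closed Jordan curve, let $\{x_k\}_{k=0}^\infty\subset\Gamma$ be an arbitrary sequence of distinct points, and let $\mathcal{X}_n=\{x_0,\dots,x_n\}$, a configuration of $N=n+1$ points. Then $\{\mathcal{X}_n\}_n\notin\mathrm{AEM}(\Gamma;s)$ for all $s>1$. In particular, if $s>1$ and $(a_n)_{n\ge1}$ is any greedy $k_s$-energy sequence on $\Gamma$, then the configurations $\alpha_{N,s}=\{a_1,\dots,a_N\}$ satisfy $\{\alpha_{N,s}\}_N\notin\mathrm{AEM}(\Gamma;s)$. -/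

import Mathlib

open Set Filter Topology MeasureTheory

noncomputable section

namespace RieszGreedy

/-- The Riesz kernel `k_s(x, y) = |x - y|^(-s)` on `ℝ^p` (for `s > 0`), with the value `+∞` on the
diagonal: in `ℝ≥0∞` one has `0 ^ (-s) = ⊤` for `s > 0`. -/
def rieszKernel {p : ℕ} (s : ℝ) (x y : EuclideanSpace ℝ (Fin p)) : ENNReal :=
  edist x y ^ (-s)

/-- The discrete Riesz `s`-energy `E_s(ω) = ∑_{i ≠ j} k_s(x_i, x_j)` (sum over ordered pairs of
different indices) of an `N`-point configuration. -/
def rieszEnergy {p N : ℕ} (s : ℝ) (ω : Fin N → EuclideanSpace ℝ (Fin p)) : ENNReal :=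
  ∑ i : Fin N, ∑ j ∈ Finset.univ.erase i, rieszKernel s (ω i) (ω j)

/-- `{ω_N} ∈ AEM(A; s)` for a set `A` of Hausdorff dimension `1` and an exponent `s > 1`: each `ω_N`
is an `N`-point configuration on `A`, and
`lim_{N → ∞} E_s(ω_N) / N^(1+s) = 2 ζ(s) / H_1(A)^s`,
the limit relation satisfied by the minimal `N`-point `s`-energies when `A` is a rectifiable Jordan arc
or closed Jordan curve. Here `H_1` is the
one-dimensional Hausdorff measure, normalized so that a unit segment has measure `1`. -/
def IsAEM {p : ℕ} (A : Set (EuclideanSpace ℝ (Fin p))) (s : ℝ)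
    (ω : (N : ℕ) → Fin N → EuclideanSpace ℝ (Fin p)) : Prop :=
  (∀ N i, ω N i ∈ A) ∧
    Tendsto (fun N : ℕ => rieszEnergy s (ω N) / (N : ENNReal) ^ (1 + s)) atTop
      (𝓝 (ENNReal.ofReal (2 * (riemannZeta (s : ℂ)).re) / Measure.hausdorffMeasure 1 A ^ s))

/-- The configuration formed by the first `N` points `x 0, …, x (N - 1)` of a sequence. -/
def initialPoints {p : ℕ} (x : ℕ → EuclideanSpace ℝ (Fin p)) (N : ℕ) :
    Fin N → EuclideanSpace ℝ (Fin p) :=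
  fun i => x i

/-- A greedy `k_s`-energy sequence `a 0, a 1, …` on `A`: the first point is arbitrary on `A`, and
each later point minimizes over `A` the sum of the kernels centred at all previous points. -/
def IsGreedySequence {p : ℕ} (A : Set (EuclideanSpace ℝ (Fin p))) (s : ℝ)
    (a : ℕ → EuclideanSpace ℝ (Fin p)) : Prop :=
  (∀ n, a n ∈ A) ∧
    ∀ n, 1 ≤ n → ∑ i ∈ Finset.range n, rieszKernel s (a n) (a i) =
      ⨅ x ∈ A, ∑ i ∈ Finset.range n, rieszKernel s x (a i)

/-- A rectifiable Jordan arc: the image of `[0, 1]` under a continuous injective map (hence a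
homeomorphism onto its image) of finite length. -/
def IsRectifiableJordanArc {p : ℕ} (Γ : Set (EuclideanSpace ℝ (Fin p))) : Prop :=
  ∃ γ : ℝ → EuclideanSpace ℝ (Fin p), ContinuousOn γ (Icc 0 1) ∧ InjOn γ (Icc 0 1) ∧
    γ '' Icc 0 1 = Γ ∧ BoundedVariationOn γ (Icc 0 1)

/-- A rectifiable closed Jordan curve: the image of `[0, 1]` under a continuous map of finite length
that takes the same value at `0` and `1` and is otherwise injective (hence a homeomorphic image of
the circle). -/
def IsRectifiableClosedJordanCurve {p : ℕ} (Γ : Set (EuclideanSpace ℝ (Fin p))) : Prop :=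
  ∃ γ : ℝ → EuclideanSpace ℝ (Fin p), ContinuousOn γ (Icc 0 1) ∧ InjOn γ (Ico 0 1) ∧
    γ 0 = γ 1 ∧ γ '' Icc 0 1 = Γ ∧ BoundedVariationOn γ (Icc 0 1)

end RieszGreedy

end

/-! Normalized arc length sends points of `Γ` to `[0, 1]`, and distances on `Γ` are at most `H_1(Γ)`
times distances of parameters. The energy on `Γ` is thus at least `H_1(Γ)^(-s)` times that of the
parameters, and the claim reduces to sequences in `[0, 1]` (`not_asymptotically_minimal_real`).

There, convexity of `u ^ (-s)`, applied to points `k` steps apart for each `k`, gives the sharp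
leading term `2 ζ(s) N^(1+s)`. Keeping the tangent-line remainder at `k = 1` shows that asymptotic
minimality forces almost all gaps to be close to `1/N` (`le_realEnergy`,
`eventually_sum_tangentExcess_le`).

Nested configurations cannot do this. Passing from `2N` to `3N` points splits at most `N` of the `2N
- 1` gaps (`card_gaps_sdiff_le`), and a surviving gap cannot be close to both `1/(2N)` and `1/(3N)`
(`le_tangentExcess_add`). -/

noncomputable section

namespace RieszGreedy

/-! ### Convexity of the kernel and its quantitative remainder. -/

/-- The excess of `u ^ (-s)` over its tangent line at `u = 1`. -/
def tangentExcess (s u : ℝ) : ℝ := u ^ (-s) + s * u - (s + 1)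

/-- This is `1 + t ≤ exp t` at `t = -s log u`. -/
lemma tangentExcess_ge {s u : ℝ} (hu : 0 < u) :
    s * (u - 1 - Real.log u) ≤ tangentExcess s u := by
  have h := Real.add_one_le_exp (Real.log u * -s)
  rw [← Real.rpow_def_of_pos hu] at h
  unfold tangentExcess
  linarith

lemma tangentExcess_nonneg {s u : ℝ} (hs : 0 ≤ s) (hu : 0 < u) : 0 ≤ tangentExcess s u :=
  (mul_nonneg hs (by linarith [Real.log_le_sub_one_of_pos hu])).trans (tangentExcess_ge hu)

/-- Scales in the ratio `2 : 3` cannot both be close to the minimum of the tangent excess. -/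
lemma le_tangentExcess_add {s d : ℝ} (hs : 0 ≤ s) (hd : 0 < d) :
    s * Real.log (25 / 24) ≤ tangentExcess s (2 * d) + tangentExcess s (3 * d) := by
  have h1 := tangentExcess_ge (s := s) (u := 2 * d) (by positivity)
  have h2 := tangentExcess_ge (s := s) (u := 3 * d) (by positivity)
  -- The function `5d - 2 - log (6d²)` is minimal at `d = 2/5`, so the logarithm is bounded at
  -- `5d/2`; `25/24` is `(5/2)² / 6`.
  have h3 := Real.log_le_sub_one_of_pos (x := 5 / 2 * d) (by positivity)
  have e : Real.log (25 / 24) + Real.log (2 * d) + Real.log (3 * d)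
      = 2 * Real.log (5 / 2 * d) := by
    rw [← Real.log_mul (by norm_num) (by positivity), ← Real.log_mul (by positivity) (by positivity),
      two_mul (Real.log _), ← Real.log_mul (by positivity) (by positivity)]
    congr 1
    ring
  have h4 : Real.log (25 / 24) ≤ (2 * d - 1 - Real.log (2 * d)) + (3 * d - 1 - Real.log (3 * d)) := by
    linarith
  nlinarith [mul_le_mul_of_nonneg_left h4 hs]

/-- The sum telescopes to the last `k` values minus the first `k`. -/
lemma sum_shift_sub_le {N k : ℕ} {z : ℕ → ℝ} (hz : ∀ i < N, z i ∈ Icc (0 : ℝ) 1) (hk : k ≤ N) :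
    ∑ i ∈ Finset.range (N - k), (z (i + k) - z i) ≤ k := by
  obtain ⟨M, rfl⟩ := Nat.exists_eq_add_of_le' hk
  have e1 := Finset.sum_range_add z M k
  have e2 := Finset.sum_range_add z k M
  rw [add_comm k M] at e2
  have h : ∑ i ∈ Finset.range k, (z (M + i) - z i) ≤ ∑ i ∈ Finset.range k, (1 : ℝ) := by
    refine Finset.sum_le_sum fun i hi => ?_
    have hi := Finset.mem_range.1 hi
    linarith [(hz (M + i) (by omega)).2, (hz i (by omega)).1]
  simp only [Finset.sum_sub_distrib, Finset.sum_const, Finset.card_range, nsmul_eq_mul,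
    mul_one] at h ⊢
  rw [Nat.add_sub_cancel]
  simp only [add_comm _ k] at e1 e2 ⊢
  linarith

lemma rpow_neg_eq_tangentExcess {s d c : ℝ} (hd : 0 < d) (hc : 0 < c) :
    d ^ (-s) = c ^ s * (tangentExcess s (c * d) + (s + 1) - s * (c * d)) := by
  have : c ^ s * (c * d) ^ (-s) = d ^ (-s) := by
    rw [Real.mul_rpow hc.le hd.le, ← mul_assoc, ← Real.rpow_add hc]
    simp
  unfold tangentExcess
  rw [← this]
  ring

/-- For equally spaced points the `k`-step differences are about `k/N`, hence the rescaling by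
`N/k`. The affine part contributes at least `(s + 1)(N - k) - sN = N - (s + 1)k`. -/
lemma le_sum_shift_rpow {s : ℝ} (hs : 0 < s) {N k : ℕ} {z : ℕ → ℝ}
    (hz : ∀ i < N, z i ∈ Icc (0 : ℝ) 1) (hmono : StrictMonoOn z (Iio N)) (hk : k ≤ N)
    (hk0 : 0 < k) :
    ((N : ℝ) / k) ^ s * ((N - (s + 1) * k) +
        ∑ i ∈ Finset.range (N - k), tangentExcess s (N / k * (z (i + k) - z i))) ≤
      ∑ i ∈ Finset.range (N - k), (z (i + k) - z i) ^ (-s) := by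
  have hN : 0 < N := by omega
  have hc : (0 : ℝ) < (N : ℝ) / k := by positivity
  have hd : ∀ i ∈ Finset.range (N - k), 0 < z (i + k) - z i := fun i hi => by
    have hi := Finset.mem_range.1 hi
    exact sub_pos.2 (hmono (show i < N by omega) (show i + k < N by omega) (by omega))
  rw [Finset.sum_congr rfl fun i hi => rpow_neg_eq_tangentExcess (hd i hi) hc, ← Finset.mul_sum]
  refine mul_le_mul_of_nonneg_left ?_ (by positivity)
  simp only [Finset.sum_sub_distrib, Finset.sum_add_distrib, ← Finset.mul_sum, Finset.sum_const,
    Finset.card_range, nsmul_eq_mul, Nat.cast_sub hk]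
  have h := sum_shift_sub_le hz hk
  rw [Finset.sum_sub_distrib] at h
  have h2 : s * ((N : ℝ) / k * (∑ i ∈ Finset.range (N - k), z (i + k)
      - ∑ i ∈ Finset.range (N - k), z i)) ≤ s * N := by
    refine mul_le_mul_of_nonneg_left ?_ hs.le
    calc _ ≤ (N : ℝ) / k * k := mul_le_mul_of_nonneg_left h hc.le
      _ = N := by field_simp
  linarith

/-! ### Gaps of finite sets and their survival under refinement. -/

/-- The pairs of consecutive points of a finite set of reals. -/
def gaps (S : Finset ℝ) : Finset (ℝ × ℝ) :=
  (S ×ˢ S).filter fun g => g.1 < g.2 ∧ ∀ c ∈ S, ¬ (g.1 < c ∧ c < g.2)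

lemma mem_gaps {S : Finset ℝ} {g : ℝ × ℝ} :
    g ∈ gaps S ↔ (g.1 ∈ S ∧ g.2 ∈ S) ∧ g.1 < g.2 ∧ ∀ c ∈ S, ¬ (g.1 < c ∧ c < g.2) := by
  simp [gaps]

lemma exists_sorted (S : Finset ℝ) :
    ∃ z : ℕ → ℝ, StrictMonoOn z (Iio S.card) ∧ S = (Finset.range S.card).image z := by
  let e := S.orderEmbOfFin rfl
  -- The value `0` beyond the cardinality is never used.
  refine ⟨fun i => if h : i < S.card then e ⟨i, h⟩ else 0, ?_, ?_⟩
  · intro i hi j hj hij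
    simp only [mem_Iio] at hi hj
    simp only [hi, hj, dif_pos]
    exact e.strictMono (by simpa using hij)
  · ext a
    simp only [Finset.mem_image, Finset.mem_range]
    constructor
    · intro ha
      have : a ∈ Set.range e := by rw [Finset.range_orderEmbOfFin]; exact ha
      obtain ⟨i, rfl⟩ := this
      exact ⟨i, i.2, by simp⟩
    · rintro ⟨i, hi, rfl⟩
      simp only [hi, dif_pos]
      exact Finset.orderEmbOfFin_mem _ _ _

lemma gaps_eq_image {N : ℕ} {z : ℕ → ℝ} (hmono : StrictMonoOn z (Iio N)) :
    gaps ((Finset.range N).image z) =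
      (Finset.range (N - 1)).image fun i => (z i, z (i + 1)) := by
  ext ⟨a, b⟩
  simp only [mem_gaps, Finset.mem_image, Finset.mem_range, Prod.mk.injEq]
  constructor
  · rintro ⟨⟨⟨i, hi, rfl⟩, ⟨j, hj, rfl⟩⟩, hij, h⟩
    have hij' : i < j := (hmono.lt_iff_lt hi hj).1 hij
    refine ⟨i, by omega, rfl, ?_⟩
    rcases (show i + 1 ≤ j from hij').eq_or_lt with e | e
    · rw [e]
    · exact absurd ⟨hmono hi (show i + 1 < N by omega) (by omega),
        hmono (show i + 1 < N by omega) hj e⟩ (h _ ⟨i + 1, by omega, rfl⟩)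
  · rintro ⟨i, hi, rfl, rfl⟩
    refine ⟨⟨⟨i, by omega, rfl⟩, ⟨i + 1, by omega, rfl⟩⟩,
      hmono (show i < N by omega) (show i + 1 < N by omega) (by omega), ?_⟩
    rintro c ⟨j, hj, rfl⟩ ⟨h1, h2⟩
    have h1 := (hmono.lt_iff_lt (show i < N by omega) hj).1 h1
    have h2 := (hmono.lt_iff_lt hj (show i + 1 < N by omega)).1 h2
    omega

lemma injOn_consecutive {N : ℕ} {z : ℕ → ℝ} (hmono : StrictMonoOn z (Iio N)) :
    Set.InjOn (fun i => (z i, z (i + 1))) (Finset.range (N - 1) : Set ℕ) := by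
  intro i hi j hj h
  simp only [Finset.coe_range, mem_Iio] at hi hj
  exact hmono.injOn (show i < N by omega) (show j < N by omega) (Prod.ext_iff.1 h).1

lemma card_gaps (S : Finset ℝ) : (gaps S).card = S.card - 1 := by
  obtain ⟨z, hz, hS⟩ := exists_sorted S
  conv_lhs => rw [hS]
  rw [gaps_eq_image hz, Finset.card_image_of_injOn (injOn_consecutive hz), Finset.card_range]

/-- Each added point destroys at most one gap. -/
lemma card_gaps_sdiff_le {S T : Finset ℝ} (hST : S ⊆ T) :
    (gaps S \ gaps T).card ≤ (T \ S).card := by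
  have h : ∀ g ∈ gaps S \ gaps T, ∃ c ∈ T \ S, g.1 < c ∧ c < g.2 := by
    intro g hg
    obtain ⟨h1, h2⟩ := Finset.mem_sdiff.1 hg
    obtain ⟨⟨ha, hb⟩, hab, hc⟩ := mem_gaps.1 h1
    by_contra! hcon
    refine h2 (mem_gaps.2 ⟨⟨hST ha, hST hb⟩, hab, fun c hcT hcg => ?_⟩)
    by_cases hcS : c ∈ S
    · exact hc c hcS hcg
    · exact absurd (hcon c (Finset.mem_sdiff.2 ⟨hcT, hcS⟩) hcg.1) (not_le.2 hcg.2)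
  choose! f hf using h
  refine Finset.card_le_card_of_injOn f (fun g hg => (hf g hg).1) ?_
  intro g hg g' hg' heq
  obtain ⟨-, l1, l2⟩ := hf g hg
  obtain ⟨-, l1', l2'⟩ := hf g' hg'
  rw [← heq] at l1' l2'
  obtain ⟨⟨ha, hb⟩, -, hc⟩ := mem_gaps.1 (Finset.mem_sdiff.1 hg).1
  obtain ⟨⟨ha', hb'⟩, -, hc'⟩ := mem_gaps.1 (Finset.mem_sdiff.1 hg').1
  -- Two gaps of `S` sharing an interior point coincide: otherwise an endpoint of one would lie
  -- inside the other.
  have e1 : g.1 = g'.1 := by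
    rcases lt_trichotomy g.1 g'.1 with h | h | h
    · exact absurd ⟨h, l1'.trans l2⟩ (hc _ ha')
    · exact h
    · exact absurd ⟨h, l1.trans l2'⟩ (hc' _ ha)
  have e2 : g.2 = g'.2 := by
    rcases lt_trichotomy g.2 g'.2 with h | h | h
    · exact absurd ⟨l1'.trans l2, h⟩ (hc' _ hb)
    · exact h
    · exact absurd ⟨l1.trans l2', h⟩ (hc _ hb')
  exact Prod.ext e1 e2

/-! ### Energy of points in `[0, 1]`. -/

/-- The Riesz energy of a finite set of reals. -/
def realEnergy (s : ℝ) (S : Finset ℝ) : ℝ :=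
  ∑ a ∈ S, ∑ b ∈ S.erase a, |a - b| ^ (-s)

lemma two_mul_sum_shift_le_realEnergy {s : ℝ} {N K : ℕ} {z : ℕ → ℝ}
    (hmono : StrictMonoOn z (Iio N)) :
    2 * ∑ k ∈ Finset.Icc 1 K, ∑ i ∈ Finset.range (N - k), (z (i + k) - z i) ^ (-s) ≤
      realEnergy s ((Finset.range N).image z) := by
  have hinj : Set.InjOn z (Finset.range N : Set ℕ) := by
    rw [Finset.coe_range]; exact hmono.injOn
  have e1 : realEnergy s ((Finset.range N).image z) =
      ∑ q ∈ (Finset.range N ×ˢ Finset.range N).filter (fun q => q.1 ≠ q.2),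
        |z q.1 - z q.2| ^ (-s) := by
    rw [realEnergy, Finset.sum_image hinj, Finset.sum_filter, Finset.sum_product]
    refine Finset.sum_congr rfl fun i hi => ?_
    rw [← Finset.sum_filter]
    have : ((Finset.range N).image z).erase (z i) =
        ((Finset.range N).filter fun j => i ≠ j).image z := by
      ext a
      simp only [Finset.mem_erase, Finset.mem_image, Finset.mem_filter]
      constructor
      · rintro ⟨h, j, hj, rfl⟩
        exact ⟨j, ⟨hj, fun h' => h (by rw [h'])⟩, rfl⟩
      · rintro ⟨j, ⟨hj, hne⟩, rfl⟩
        exact ⟨fun h => hne (hinj hj hi h).symm, j, hj, rfl⟩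
    rw [this, Finset.sum_image (hinj.mono (Finset.coe_subset.2 (Finset.filter_subset _ _)))]
  set P := (Finset.Icc 1 K).sigma fun k => Finset.range (N - k)
  have e2 : ∑ k ∈ Finset.Icc 1 K, ∑ i ∈ Finset.range (N - k), (z (i + k) - z i) ^ (-s) =
      ∑ x ∈ P, (z (x.2 + x.1) - z x.2) ^ (-s) := by
    simp only [P, Finset.sum_sigma]
  -- `f` and `g` list each pair at index distance at most `K` in its two orders; the other pairs are
  -- discarded.
  let f : (Σ _ : ℕ, ℕ) → ℕ × ℕ := fun x => (x.2, x.2 + x.1)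
  let g : (Σ _ : ℕ, ℕ) → ℕ × ℕ := fun x => (x.2 + x.1, x.2)
  have hf : Set.InjOn f P := by
    rintro ⟨a, b⟩ - ⟨c, d⟩ - h
    simp only [f, Prod.mk.injEq] at h
    obtain ⟨rfl, h⟩ := h
    obtain rfl : a = c := by omega
    rfl
  have hg : Set.InjOn g P := by
    rintro ⟨a, b⟩ - ⟨c, d⟩ - h
    simp only [g, Prod.mk.injEq] at h
    obtain ⟨h, rfl⟩ := h
    obtain rfl : a = c := by omega
    rfl
  have hP : ∀ x ∈ P, 1 ≤ x.1 ∧ x.2 + x.1 < N := by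
    rintro ⟨a, b⟩ h
    simp only [P, Finset.mem_sigma, Finset.mem_Icc, Finset.mem_range] at h
    dsimp only
    omega
  have hpos : ∀ x ∈ P, |z (x.2 + x.1) - z x.2| = z (x.2 + x.1) - z x.2 := fun x hx => by
    have := hP x hx
    exact abs_of_pos (sub_pos.2 (hmono (show x.2 < N by omega) this.2 (by omega)))
  have hdisj : Disjoint (P.image f) (P.image g) := by
    rw [Finset.disjoint_left]
    rintro q h1 h2
    obtain ⟨x, hx, rfl⟩ := Finset.mem_image.1 h1
    obtain ⟨y, hy, h⟩ := Finset.mem_image.1 h2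
    simp only [f, g, Prod.mk.injEq] at h
    have := hP x hx
    have := hP y hy
    omega
  rw [e1, e2]
  calc 2 * ∑ x ∈ P, (z (x.2 + x.1) - z x.2) ^ (-s)
      = ∑ q ∈ P.image f ∪ P.image g, |z q.1 - z q.2| ^ (-s) := by
        rw [Finset.sum_union hdisj, Finset.sum_image hf, Finset.sum_image hg, two_mul]
        refine congrArg₂ _ ?_ ?_ <;> refine Finset.sum_congr rfl fun x hx => ?_
        · rw [abs_sub_comm, hpos x hx]
        · rw [hpos x hx]
    _ ≤ _ := by
        refine Finset.sum_le_sum_of_subset_of_nonneg ?_ fun q _ _ =>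
          Real.rpow_nonneg (abs_nonneg _) _
        intro q hq
        simp only [Finset.mem_union, Finset.mem_image] at hq
        simp only [Finset.mem_filter, Finset.mem_product, Finset.mem_range]
        rcases hq with ⟨x, hx, rfl⟩ | ⟨x, hx, rfl⟩ <;> have := hP x hx <;> simp only [f, g] <;> omega

/-- A lower bound for the energy of points in `[0, 1]` with the excess of the gaps retained. -/
lemma le_realEnergy {s : ℝ} (hs : 0 < s) {S : Finset ℝ} (hS : ∀ a ∈ S, a ∈ Icc (0 : ℝ) 1)
    {K : ℕ} (hK : 1 ≤ K) (hKS : K ≤ S.card) :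
    2 * (S.card : ℝ) ^ s * (∑ k ∈ Finset.Icc 1 K, (k : ℝ) ^ (-s) * (S.card - (s + 1) * k) +
      ∑ g ∈ gaps S, tangentExcess s (S.card * (g.2 - g.1))) ≤ realEnergy s S := by
  obtain ⟨z, hz, hSz⟩ := exists_sorted S
  generalize hN : S.card = N at *
  have hz01 : ∀ i < N, z i ∈ Icc (0 : ℝ) 1 := fun i hi =>
    hS _ (by rw [hSz]; exact Finset.mem_image_of_mem _ (Finset.mem_range.2 hi))
  have hE := two_mul_sum_shift_le_realEnergy (s := s) (K := K) hz
  rw [hSz, gaps_eq_image hz, Finset.sum_image (injOn_consecutive hz)]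
  refine le_trans ?_ hE
  rw [mul_assoc]
  refine mul_le_mul_of_nonneg_left ?_ two_pos.le
  -- Only the excess of the one-step differences is kept; for `k > 1` it is dropped as nonnegative.
  have hterm : ∀ k ∈ Finset.Icc 1 K, (N : ℝ) ^ s * ((k : ℝ) ^ (-s) * (N - (s + 1) * k) +
      if k = 1 then ∑ i ∈ Finset.range (N - 1), tangentExcess s (N * (z (i + 1) - z i)) else 0) ≤
      ∑ i ∈ Finset.range (N - k), (z (i + k) - z i) ^ (-s) := by
    intro k hk
    obtain ⟨hk1, hkK⟩ := Finset.mem_Icc.1 hk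
    refine le_trans ?_ (le_sum_shift_rpow hs hz01 hz (hkK.trans hKS) hk1)
    split_ifs with h
    · subst h; simp
    · have e : ((N : ℝ) / k) ^ s = (N : ℝ) ^ s * (k : ℝ) ^ (-s) := by
        rw [Real.div_rpow (by positivity) (by positivity), Real.rpow_neg (by positivity)]; rfl
      rw [add_zero, ← mul_assoc, ← e]
      refine mul_le_mul_of_nonneg_left ?_ (by positivity)
      refine le_add_of_nonneg_right (Finset.sum_nonneg fun i hi => tangentExcess_nonneg hs.le ?_)
      have hi := Finset.mem_range.1 hi
      have : 0 < z (i + k) - z i :=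
        sub_pos.2 (hz (show i < N by omega) (show i + k < N by omega) (by omega))
      have : 0 < N := by omega
      positivity
  refine le_trans (le_of_eq ?_) (Finset.sum_le_sum hterm)
  rw [← Finset.mul_sum, Finset.sum_add_distrib, Finset.sum_ite_eq' (Finset.Icc 1 K),
    if_pos (Finset.mem_Icc.2 ⟨le_rfl, hK⟩)]

/-- If the energies of the initial segments are asymptotically minimal, the total tangent excess of
the normalized gaps is `o(N)`. -/
lemma eventually_sum_tangentExcess_le {s Z : ℝ} (hs : 0 < s) {y : ℕ → ℝ}
    (hy : Function.Injective y) (hy01 : ∀ n, y n ∈ Icc (0 : ℝ) 1)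
    (hZ : HasSum (fun n : ℕ => ((n : ℝ) + 1) ^ (-s)) Z)
    (hE : ∀ ε > 0, ∀ᶠ N : ℕ in atTop,
      realEnergy s ((Finset.range N).image y) ≤ (2 * Z + ε) * (N : ℝ) ^ (1 + s))
    {ε : ℝ} (hε : 0 < ε) :
    ∀ᶠ N : ℕ in atTop, ∑ g ∈ gaps ((Finset.range N).image y),
      tangentExcess s (N * (g.2 - g.1)) ≤ ε * N := by
  -- The error `ε` splits into `ε/4` from truncating the series at `K`, `ε/4` from the energy
  -- hypothesis, and `ε/2` from the constant `B` once `N` is large.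
  obtain ⟨K, hKZ, hK⟩ := ((hZ.tendsto_sum_nat.eventually
    (lt_mem_nhds (show Z - ε / 4 < Z by linarith))).and (eventually_ge_atTop 1)).exists
  have hA : ∑ k ∈ Finset.Icc 1 K, (k : ℝ) ^ (-s) = ∑ i ∈ Finset.range K, ((i : ℝ) + 1) ^ (-s) := by
    rw [← Finset.Ico_add_one_right_eq_Icc, Finset.sum_Ico_eq_sum_range]
    simp [add_comm]
  set B := ∑ k ∈ Finset.Icc 1 K, (k : ℝ) ^ (-s) * ((s + 1) * k) with hB
  filter_upwards [hE (ε / 2) (by positivity), eventually_ge_atTop K,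
    tendsto_natCast_atTop_atTop.eventually_ge_atTop (2 * B / ε)] with N h1 h2 h3
  have hcard : ((Finset.range N).image y).card = N := by
    rw [Finset.card_image_of_injective _ hy, Finset.card_range]
  have hle := le_realEnergy hs (S := (Finset.range N).image y)
    (fun a ha => by obtain ⟨n, -, rfl⟩ := Finset.mem_image.1 ha; exact hy01 n) hK (by rwa [hcard])
  rw [hcard] at hle
  have hN : (0 : ℝ) < N := by exact_mod_cast (show 0 < N by omega)
  have h4 := hle.trans h1
  simp only [mul_sub, Finset.sum_sub_distrib, ← Finset.sum_mul, ← hB, hA] at h4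
  rw [Real.rpow_add hN, Real.rpow_one] at h4
  have hNs : 0 < (N : ℝ) ^ s := by positivity
  set A := ∑ i ∈ Finset.range K, ((i : ℝ) + 1) ^ (-s)
  have h5 : 2 * (A * N - B + ∑ g ∈ gaps ((Finset.range N).image y),
      tangentExcess s (N * (g.2 - g.1))) ≤ (2 * Z + ε / 2) * N := by
    refine le_of_mul_le_mul_left ?_ hNs
    simp only [mul_sub]
    linarith
  rw [div_le_iff₀ hε] at h3
  have h6 := mul_le_mul_of_nonneg_right hKZ.le hN.le
  linarith

/-- The initial segments of a sequence of distinct points of `[0, 1]` cannot have asymptotically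
minimal energy. -/
theorem not_asymptotically_minimal_real {s Z : ℝ} (hs : 0 < s) {y : ℕ → ℝ}
    (hy : Function.Injective y) (hy01 : ∀ n, y n ∈ Icc (0 : ℝ) 1)
    (hZ : HasSum (fun n : ℕ => ((n : ℝ) + 1) ^ (-s)) Z) :
    ¬ ∀ ε > 0, ∀ᶠ N : ℕ in atTop,
      realEnergy s ((Finset.range N).image y) ≤ (2 * Z + ε) * (N : ℝ) ^ (1 + s) := by
  intro hE
  set c := s * Real.log (25 / 24)
  have hc : 0 < c := mul_pos hs (Real.log_pos (by norm_num))
  -- The excesses at `2N` and `3N` then total at most `5N · c/10 = cN/2`, less than the `(N - 1)c`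
  -- forced by common gaps as soon as `N ≥ 3`.
  have key := eventually_sum_tangentExcess_le hs hy hy01 hZ hE (ε := c / 10) (by positivity)
  obtain ⟨N, h2, h3, hN⟩ := (((tendsto_id.const_mul_atTop' (show 0 < 2 by norm_num)).eventually
    key).and (((tendsto_id.const_mul_atTop' (show 0 < 3 by norm_num)).eventually key).and
    (eventually_ge_atTop 3))).exists
  simp only [id] at h2 h3
  set S := (Finset.range (2 * N)).image y
  set T := (Finset.range (3 * N)).image y
  have hST : S ⊆ T := Finset.image_subset_image (Finset.range_subset_range.2 (by omega))
  have hS : S.card = 2 * N := by rw [Finset.card_image_of_injective _ hy, Finset.card_range]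
  have hT : T.card = 3 * N := by rw [Finset.card_image_of_injective _ hy, Finset.card_range]
  have hcommon : N - 1 ≤ (gaps S ∩ gaps T).card := by
    have e1 := card_gaps_sdiff_le hST
    have e2 := Finset.card_sdiff_add_card_eq_card hST
    have e3 := Finset.card_inter_add_card_sdiff (gaps S) (gaps T)
    have e4 := card_gaps S
    omega
  have hnn : ∀ {U : Finset ℝ} {M : ℕ}, 0 < M → ∀ g ∈ gaps U,
      0 ≤ tangentExcess s ((M : ℕ) * (g.2 - g.1)) := by
    intro U M hM g hg
    have := sub_pos.2 (mem_gaps.1 hg).2.1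
    exact tangentExcess_nonneg hs.le (by positivity)
  have i2 := (Finset.sum_le_sum_of_subset_of_nonneg (Finset.inter_subset_left (s₁ := gaps S)
    (s₂ := gaps T)) fun g hg _ => hnn (M := 2 * N) (by omega) g hg).trans h2
  have i3 := (Finset.sum_le_sum_of_subset_of_nonneg (Finset.inter_subset_right (s₁ := gaps S)
    (s₂ := gaps T)) fun g hg _ => hnn (M := 3 * N) (by omega) g hg).trans h3
  have i4 : ((gaps S ∩ gaps T).card : ℝ) * c ≤ ∑ g ∈ gaps S ∩ gaps T,
      (tangentExcess s ((2 * N : ℕ) * (g.2 - g.1)) +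
        tangentExcess s ((3 * N : ℕ) * (g.2 - g.1))) := by
    rw [← nsmul_eq_mul]
    refine Finset.card_nsmul_le_sum _ _ _ fun g hg => ?_
    have := sub_pos.2 (mem_gaps.1 (Finset.mem_inter.1 hg).1).2.1
    have hN' : 0 < N := by omega
    push_cast
    rw [mul_assoc, mul_assoc]
    exact le_tangentExcess_add hs.le (by positivity)
  rw [Finset.sum_add_distrib] at i4
  have hcommon' : (N : ℝ) - 1 ≤ (gaps S ∩ gaps T).card := by
    have : (N : ℝ) ≤ (gaps S ∩ gaps T).card + 1 := by exact_mod_cast (by omega)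
    linarith
  have hN' : (3 : ℝ) ≤ N := by exact_mod_cast hN
  have i5 := mul_le_mul_of_nonneg_right hcommon' hc.le
  push_cast at i2 i3 i4
  have i6 := mul_le_mul_of_nonneg_right hN' hc.le
  linarith

/-! ### Length of curves and the arc length coordinate. -/

/-- Finite variation implies finite length. -/
lemma hausdorffMeasure_image_lt_top {E : Type*} [MetricSpace E] [MeasurableSpace E] [BorelSpace E]
    {γ : ℝ → E} (hγ : BoundedVariationOn γ (Icc 0 1)) :
    Measure.hausdorffMeasure 1 (γ '' Icc 0 1) < ⊤ := by
  have hl := hγ.locallyBoundedVariationOn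
  have h0 : (0 : ℝ) ∈ Icc (0 : ℝ) 1 := by simp
  have h1 : (1 : ℝ) ∈ Icc (0 : ℝ) 1 := by simp
  -- On `[0, 1]`, `γ` factors as `g ∘ v` with `v` monotone, hence of bounded range, and `g` of unit
  -- speed, hence 1-Lipschitz.
  set v := variationOnFromTo γ (Icc 0 1) 0
  set g := naturalParameterization γ (Icc 0 1) 0
  have hv : MonotoneOn v (Icc 0 1) := variationOnFromTo.monotoneOn hl h0
  have hu : HasUnitSpeedOn g (v '' Icc 0 1) := has_unit_speed_naturalParameterization γ hl h0
  have hg : ∀ t ∈ Icc (0 : ℝ) 1, g (v t) = γ t := fun t ht =>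
    edist_eq_zero.1 (edist_naturalParameterization_eq_zero hl h0 ht)
  have hlip : LipschitzOnWith 1 g (v '' Icc 0 1) := by
    intro a ha b hb
    wlog hab : a ≤ b generalizing a b
    · rw [edist_comm, edist_comm a]
      exact this hb ha (le_of_not_ge hab)
    refine (eVariationOn.edist_le g (s := v '' Icc 0 1 ∩ Icc a b) ⟨ha, le_rfl, hab⟩
      ⟨hb, hab, le_rfl⟩).trans ?_
    rw [hu ha hb, edist_comm, edist_dist, Real.dist_eq, abs_of_nonneg (sub_nonneg.2 hab)]
    simp
  have himg : γ '' Icc 0 1 = g '' (v '' Icc 0 1) := by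
    rw [image_image]
    exact image_congr fun t ht => (hg t ht).symm
  rw [himg]
  refine (hlip.hausdorffMeasure_image_le zero_le_one).trans_lt ?_
  rw [hausdorffMeasure_real]
  simp only [ENNReal.coe_one, ENNReal.one_rpow, one_mul]
  refine (measure_mono (?_ : v '' Icc 0 1 ⊆ Icc (v 0) (v 1))).trans_lt measure_Icc_lt_top
  rintro _ ⟨t, ht, rfl⟩
  exact ⟨hv h0 ht ht.1, hv ht h1 ht.2⟩

/-- The length of a curve is at least the distance of its end points. -/
lemma ofReal_dist_le_hausdorffMeasure_image {E : Type*} [MetricSpace E] [MeasurableSpace E]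
    [BorelSpace E] {γ : ℝ → E} {a b : ℝ} (hab : a ≤ b) (hγ : ContinuousOn γ (Icc a b)) :
    ENNReal.ofReal (dist (γ a) (γ b)) ≤ Measure.hausdorffMeasure 1 (γ '' Ioc a b) := by
  have hf : ContinuousOn (fun t => dist (γ t) (γ a)) (Icc a b) := by fun_prop
  -- The distance to `γ a` is 1-Lipschitz and maps the half-open piece onto a set containing `(0,
  -- dist (γ b) (γ a)]`.
  have h1 := intermediate_value_Ioc hab hf
  have h2 := (LipschitzWith.dist_left (γ a)).hausdorffMeasure_image_le zero_le_one (γ '' Ioc a b)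
  rw [image_image, hausdorffMeasure_real] at h2
  have h3 := (measure_mono (μ := volume) h1).trans h2
  simpa [Real.volume_Ioc, dist_comm] using h3

/-- An injective curve of finite length dominates the distances on the real line of its points'
arc length coordinates. -/
lemma exists_arcLength_coordinate {E : Type*} [MetricSpace E] [MeasurableSpace E] [BorelSpace E]
    {γ : ℝ → E} {I : Set ℝ} (hγ : ContinuousOn γ I) (hinj : InjOn γ I)
    (h0 : ∀ t ∈ I, 0 ≤ t) (hI : ∀ t ∈ I, Icc 0 t ⊆ I)
    (hfin : Measure.hausdorffMeasure 1 (γ '' I) < ⊤) :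
    ∃ G : E → ℝ, ∀ x ∈ γ '' I,
      G x ∈ Icc 0 (Measure.hausdorffMeasure 1 (γ '' I)).toReal ∧
      ∀ y ∈ γ '' I, dist x y ≤ |G x - G y| := by
  set μ : Measure E := Measure.hausdorffMeasure 1
  let F : ℝ → ℝ := fun t => (μ (γ '' Icc 0 t)).toReal
  have hsub : ∀ t ∈ I, μ (γ '' Icc 0 t) ≤ μ (γ '' I) := fun t ht =>
    measure_mono (image_mono (hI t ht))
  have hF : ∀ a ∈ I, ∀ b ∈ I, a ≤ b → dist (γ a) (γ b) ≤ F b - F a := by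
    intro a ha b hb hab
    -- Half-open pieces have disjoint images under the injective `γ`, so their lengths add.
    have hsplit : Icc 0 a ∪ Ioc a b = Icc 0 b := Icc_union_Ioc_eq_Icc (h0 a ha) hab
    have hIoc : Ioc a b ⊆ I := (subset_union_right.trans hsplit.subset).trans (hI b hb)
    have hdisj : Disjoint (γ '' Ioc a b) (γ '' Icc 0 a) :=
      Disjoint.image (disjoint_left.2 fun t ht ht' => not_le.2 ht.1 ht'.2) hinj hIoc (hI a ha)
    have hmeas : MeasurableSet (γ '' Icc 0 a) :=
      (isCompact_Icc.image_of_continuousOn (hγ.mono (hI a ha))).measurableSet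
    have hadd : μ (γ '' Icc 0 b) = μ (γ '' Ioc a b) + μ (γ '' Icc 0 a) := by
      rw [← hsplit, image_union, union_comm, measure_union hdisj hmeas]
    have hIcc : Icc a b ⊆ I := (Icc_subset_Icc_left (h0 a ha)).trans (hI b hb)
    have hd := ofReal_dist_le_hausdorffMeasure_image hab (hγ.mono hIcc)
    have hfa : μ (γ '' Icc 0 a) ≠ ⊤ := ((hsub a ha).trans_lt hfin).ne
    have hfab : μ (γ '' Ioc a b) ≠ ⊤ := ((measure_mono (image_mono hIoc)).trans_lt hfin).ne
    have := (ENNReal.ofReal_le_iff_le_toReal hfab).1 hd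
    simp only [F]
    rw [hadd, ENNReal.toReal_add hfab hfa]
    linarith
  have hG : ∀ t ∈ I, Function.invFunOn γ I (γ t) = t := fun t ht => hinj.leftInvOn_invFunOn ht
  refine ⟨fun x => F (Function.invFunOn γ I x), ?_⟩
  rintro _ ⟨a, ha, rfl⟩
  simp only [hG a ha]
  refine ⟨⟨ENNReal.toReal_nonneg, ENNReal.toReal_mono hfin.ne (hsub a ha)⟩, ?_⟩
  rintro _ ⟨b, hb, rfl⟩
  simp only [hG b hb]
  rcases le_total a b with h | h
  · rw [abs_sub_comm]
    exact (hF a ha b hb h).trans (le_abs_self _)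
  · rw [dist_comm]
    exact (hF b hb a ha h).trans (le_abs_self _)

/-- Cutting a closed curve at its base point, with `I = Ico 0 1`, lets arcs and closed curves be
treated alike. -/
lemma exists_parametrization {p : ℕ} {Γ : Set (EuclideanSpace ℝ (Fin p))}
    (hΓ : IsRectifiableJordanArc Γ ∨ IsRectifiableClosedJordanCurve Γ) :
    ∃ (γ : ℝ → EuclideanSpace ℝ (Fin p)) (I : Set ℝ), ContinuousOn γ I ∧ InjOn γ I ∧
      (∀ t ∈ I, 0 ≤ t) ∧ (∀ t ∈ I, Icc 0 t ⊆ I) ∧ Ico 0 1 ⊆ I ∧ γ '' I = Γ ∧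
      Measure.hausdorffMeasure 1 Γ < ⊤ := by
  rcases hΓ with ⟨γ, hc, hi, rfl, hv⟩ | ⟨γ, hc, hi, h01, rfl, hv⟩
  · exact ⟨γ, Icc 0 1, hc, hi, fun t ht => ht.1, fun t ht => Icc_subset_Icc_right ht.2,
      Ico_subset_Icc_self, rfl, hausdorffMeasure_image_lt_top hv⟩
  · refine ⟨γ, Ico 0 1, hc.mono Ico_subset_Icc_self, hi, fun t ht => ht.1,
      fun t ht u hu => ⟨hu.1, hu.2.trans_lt ht.2⟩, Subset.rfl, ?_, hausdorffMeasure_image_lt_top hv⟩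
    refine (image_mono Ico_subset_Icc_self).antisymm ?_
    rintro _ ⟨t, ht, rfl⟩
    rcases ht.2.eq_or_lt with rfl | h
    · exact ⟨0, by simp, h01⟩
    · exact ⟨t, ⟨ht.1, h⟩, rfl⟩

/-! ### Transfer from the parameter interval to the curve. -/

lemma hasSum_riemannZeta_re {s : ℝ} (hs : 1 < s) :
    HasSum (fun n : ℕ => ((n : ℝ) + 1) ^ (-s)) (riemannZeta (s : ℂ)).re := by
  have hsum : Summable (fun n : ℕ => ((n : ℝ) + 1) ^ (-s)) := by
    have := (summable_nat_add_iff 1).2 (Real.summable_nat_rpow.2 (neg_lt_neg hs))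
    simpa using this
  have h : riemannZeta (s : ℂ) = ((∑' n : ℕ, ((n : ℝ) + 1) ^ (-s) : ℝ) : ℂ) := by
    rw [zeta_eq_tsum_one_div_nat_add_one_cpow (by simpa using hs), Complex.ofReal_tsum]
    refine tsum_congr fun n => ?_
    rw [Complex.ofReal_cpow (by positivity)]
    push_cast
    rw [Complex.cpow_neg, one_div]
  rw [h, Complex.ofReal_re]
  exact hsum.hasSum

/-- The kernel decreases with distance, and chords are no longer than `L` times parameter distances.
-/
lemma ofReal_realEnergy_le_rieszEnergy {p : ℕ} {s L : ℝ} (hs : 0 < s) (hL : 0 < L)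
    {x : ℕ → EuclideanSpace ℝ (Fin p)} {y : ℕ → ℝ} (hy : Function.Injective y)
    (hxy : ∀ i j, dist (x i) (x j) ≤ L * |y i - y j|) (N : ℕ) :
    ENNReal.ofReal (L ^ (-s) * realEnergy s ((Finset.range N).image y)) ≤
      rieszEnergy s (initialPoints x N) := by
  simp only [realEnergy, rieszEnergy, initialPoints, rieszKernel, ← Finset.filter_ne',
    Finset.sum_filter, Finset.sum_image hy.injOn, Finset.sum_range, Finset.mul_sum]
  rw [ENNReal.ofReal_sum_of_nonneg fun i _ => by positivity]
  refine Finset.sum_le_sum fun i _ => ?_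
  rw [ENNReal.ofReal_sum_of_nonneg fun j _ => by positivity]
  refine Finset.sum_le_sum fun j _ => ?_
  by_cases hij : j = i
  · simp [hij]
  · have hne : y j ≠ y i := fun h => hij (Fin.ext (hy h))
    have hr : 0 < |y i - y j| := abs_pos.2 (sub_ne_zero.2 hne.symm)
    rw [if_pos hne, if_pos hij, ← Real.mul_rpow hL.le hr.le,
      ← ENNReal.ofReal_rpow_of_pos (by positivity), ENNReal.rpow_neg, ENNReal.rpow_neg,
      ENNReal.inv_le_inv, edist_dist]
    exact ENNReal.rpow_le_rpow (ENNReal.ofReal_le_ofReal (hxy i j)) hs.le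

/-- Initial segments of a sequence of distinct points are not asymptotically energy minimizing. -/
theorem not_isAEM_initialPoints {p : ℕ} {Γ : Set (EuclideanSpace ℝ (Fin p))}
    (hΓ : IsRectifiableJordanArc Γ ∨ IsRectifiableClosedJordanCurve Γ)
    {x : ℕ → EuclideanSpace ℝ (Fin p)} (hxΓ : ∀ k, x k ∈ Γ) (hx : Function.Injective x)
    {s : ℝ} (hs : 1 < s) : ¬ IsAEM Γ s (initialPoints x) := by
  rintro ⟨-, hlim⟩
  obtain ⟨γ, I, hc, hi, h0, hI, -, rfl, hfin⟩ := exists_parametrization hΓ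
  obtain ⟨G, hG⟩ := exists_arcLength_coordinate hc hi h0 hI hfin
  set H := Measure.hausdorffMeasure 1 (γ '' I)
  set L := H.toReal
  have hs0 : 0 < s := by linarith
  have hdist : ∀ i j, dist (x i) (x j) ≤ |G (x i) - G (x j)| := fun i j =>
    (hG _ (hxΓ i)).2 _ (hxΓ j)
  have hL : 0 < L := by
    have h1 := dist_pos.2 (hx.ne zero_ne_one)
    have h2 := (hG _ (hxΓ 0)).1
    have h3 := (hG _ (hxΓ 1)).1
    have h4 := (hdist 0 1).trans (abs_sub_le_of_le_of_le h2.1 h2.2 h3.1 h3.2)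
    linarith
  let y : ℕ → ℝ := fun n => G (x n) / L
  have hxy : ∀ i j, dist (x i) (x j) ≤ L * |y i - y j| := fun i j => by
    refine (hdist i j).trans_eq ?_
    rw [← sub_div, abs_div, abs_of_pos hL, mul_div_cancel₀ _ hL.ne']
  have hy : Function.Injective y := fun i j h => hx (dist_le_zero.1 (by simpa [h] using hxy i j))
  have hy01 : ∀ n, y n ∈ Icc (0 : ℝ) 1 := fun n =>
    ⟨div_nonneg (hG _ (hxΓ n)).1.1 hL.le, (div_le_one hL).2 (hG _ (hxΓ n)).1.2⟩
  refine not_asymptotically_minimal_real hs0 hy hy01 (hasSum_riemannZeta_re hs) fun ε hε => ?_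
  set Z := (riemannZeta (s : ℂ)).re
  have hZ : 0 ≤ Z := (hasSum_riemannZeta_re hs).nonneg fun n => by positivity
  have hval : ENNReal.ofReal (2 * Z) / H ^ s = ENNReal.ofReal (L ^ (-s) * (2 * Z)) := by
    rw [← ENNReal.ofReal_toReal hfin.ne, ENNReal.ofReal_rpow_of_pos hL,
      ← ENNReal.ofReal_div_of_pos (by positivity), Real.rpow_neg hL.le, div_eq_inv_mul]
  rw [hval] at hlim
  have hlt : ENNReal.ofReal (L ^ (-s) * (2 * Z)) < ENNReal.ofReal (L ^ (-s) * (2 * Z + ε)) :=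
    (ENNReal.ofReal_lt_ofReal_iff (by positivity)).2
      (mul_lt_mul_of_pos_left (by linarith) (by positivity))
  filter_upwards [hlim.eventually (gt_mem_nhds hlt), eventually_gt_atTop 0] with N hN hN0
  have hN0' : (0 : ℝ) < N := by exact_mod_cast hN0
  have hcast : (N : ENNReal) ^ (1 + s) = ENNReal.ofReal ((N : ℝ) ^ (1 + s)) := by
    rw [← ENNReal.ofReal_natCast, ENNReal.ofReal_rpow_of_pos hN0']
  have hpow : 0 < (N : ℝ) ^ (1 + s) := by positivity
  rw [hcast] at hN
  have h1 := (ENNReal.div_le_iff (by simpa using hpow) ENNReal.ofReal_ne_top).1 hN.le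
  rw [← ENNReal.ofReal_mul (by positivity)] at h1
  have h2 := (ENNReal.ofReal_le_ofReal_iff (by positivity)).1
    ((ofReal_realEnergy_le_rieszEnergy hs0 hL hy hxy N).trans h1)
  rw [mul_assoc] at h2
  exact le_of_mul_le_mul_left h2 (by positivity)

/-! ### Greedy sequences. -/

/-- The points of a greedy sequence on an infinite set are distinct. -/
lemma IsGreedySequence.injective {p : ℕ} {A : Set (EuclideanSpace ℝ (Fin p))} (hA : A.Infinite)
    {s : ℝ} (hs : 0 < s) {a : ℕ → EuclideanSpace ℝ (Fin p)} (ha : IsGreedySequence A s a) :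
    Function.Injective a := by
  have key : ∀ i n, i < n → a n ≠ a i := by
    intro i n hin heq
    -- A repeated point has infinite potential, whereas any unused point of `A` has finite
    -- potential, contradicting minimality.
    have htop : ∑ i ∈ Finset.range n, rieszKernel s (a n) (a i) = ⊤ :=
      ENNReal.sum_eq_top.2 ⟨i, Finset.mem_range.2 hin, by simp [rieszKernel, heq, hs]⟩
    obtain ⟨x, hxA, hx⟩ := hA.exists_notMem_finset ((Finset.range n).image a)
    have hlt : ∑ i ∈ Finset.range n, rieszKernel s x (a i) < ⊤ := by
      refine ENNReal.sum_lt_top.2 fun j hj => ?_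
      have hne : x ≠ a j := fun h => hx (h ▸ Finset.mem_image_of_mem a hj)
      exact (ENNReal.rpow_ne_top_of_ne_zero (edist_pos.2 hne).ne' (edist_ne_top _ _)).lt_top
    rw [ha.2 n (by omega)] at htop
    exact hlt.ne (top_le_iff.1 (htop.ge.trans (iInf₂_le x hxA)))
  intro i j h
  rcases lt_trichotomy i j with hij | hij | hij
  · exact absurd h.symm (key i j hij)
  · exact hij
  · exact absurd h (key j i hij)

lemma infinite_of_jordan {p : ℕ} {Γ : Set (EuclideanSpace ℝ (Fin p))}
    (hΓ : IsRectifiableJordanArc Γ ∨ IsRectifiableClosedJordanCurve Γ) : Γ.Infinite := by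
  obtain ⟨γ, I, -, hi, -, -, hsub, rfl, -⟩ := exists_parametrization hΓ
  exact ((Ico_infinite zero_lt_one).mono hsub).image hi

end RieszGreedy
end

theorem theorem2p6 (p : ℕ) (Γ : Set (EuclideanSpace ℝ (Fin p)))
    (hΓ : RieszGreedy.IsRectifiableJordanArc Γ ∨ RieszGreedy.IsRectifiableClosedJordanCurve Γ) :
    (∀ x : ℕ → EuclideanSpace ℝ (Fin p), (∀ k, x k ∈ Γ) → Function.Injective x →
      ∀ s : ℝ, 1 < s → ¬ RieszGreedy.IsAEM Γ s (RieszGreedy.initialPoints x)) ∧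
    (∀ s : ℝ, 1 < s → ∀ a : ℕ → EuclideanSpace ℝ (Fin p), RieszGreedy.IsGreedySequence Γ s a →
      ¬ RieszGreedy.IsAEM Γ s (RieszGreedy.initialPoints a)) :=
  ⟨fun _ hxΓ hx _ hs => RieszGreedy.not_isAEM_initialPoints hΓ hxΓ hx hs,
    fun _ hs _ ha => RieszGreedy.not_isAEM_initialPoints hΓ ha.1
      (ha.injective (RieszGreedy.infinite_of_jordan hΓ) (zero_lt_one.trans hs)) hs⟩
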